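/- Let $n\in(-1,1)$ and let $L^2_{\sin\theta}(0,\pi)$ be the Hilbert space of complex-valued functions on $(0,\pi)$ that are square integrable with respect to the weight $\sin\theta$. Consider the Legendre differential expression $$\mathscr{L}^n_n u=\frac{d^2u}{d\theta^2}+\cot\theta\,\frac{du}{d\theta}+\Big((n+1)n-\frac{n^2}{\sin^2\theta}\Big)u$$ with maximal domain $$D_{\max}=\Big\{u\in L^2_{\sin\theta}(0,\pi):\ \frac{du}{d\theta}\in \mathrm{AC}_{\mathrm{loc}}(0,\pi),\ \mathscr{L}^n_nu\in L^2_{\sin\theta}(0,\pi)\Big\},$$ where $\mathrm{AC}_{\mathrm{loc}}(0,\pi)$ denotes the functions that are absolutely continuous on every compact subinterval of $(0,\pi)$, and the elements of $D_{\max}$ are identified with their differentiable representatives. Put $$D_{\mathrm{S.A.}}=\Big\{u\in D_{\max}:\ \lim_{\theta\to0^+}\sin^{2n+1}\theta\,\frac{d}{d\theta}\Big(\frac{u}{\sin^n\theta}\Big)=0\ \text{ and }\ \lim_{\theta\to\pi^-}\sin^{2n+1}\theta\,\frac{d}{d\theta}\Big(\frac{u}{\sin^n\theta}\Big)=0\Big\}.$$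 Then $D_{\mathrm{S.A.}}\subseteq D_{\max}$ is a self-adjoint domain for $\mathscr{L}^n_n$, that is, the restriction of $\mathscr{L}^n_n$ to $D_{\mathrm{S.A.}}$ is a self-adjoint (unbounded) operator on $L^2_{\sin\theta}(0,\pi)$. Furthermore, for every constant $C_0\in\mathbb{R}$, with $s_{\mathrm{Hopf}}=C_0\sin^{2n+2}\theta$ (the astigmatism of a linear Hopf sphere), the stationary profile $s_{\mathrm{Hopf}}/\sin^{n+2}\theta=C_0\sin^n\theta$ belongs to $D_{\mathrm{S.A.}}$. -/

import Mathlib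

open MeasureTheory Set Filter Topology

noncomputable section

namespace LegendreSL

/-- The measure `sin θ dθ` on the open interval `(0, π)`. -/
def sinMeasure : Measure ℝ :=
  (volume.restrict (Ioo 0 Real.pi)).withDensity (fun θ => ENNReal.ofReal (Real.sin θ))

/-- The complex Hilbert space `L²((0, π), sin θ dθ; ℂ)`. -/
abbrev L2sin : Type := Lp ℂ 2 sinMeasure

/-- `f ∈ AC_loc(0, π)`: absolute continuity on every compact subinterval of `(0, π)`. -/
def ACLoc (f : ℝ → ℂ) : Prop :=
  ∀ c d : ℝ, 0 < c → c ≤ d → d < Real.pi → AbsolutelyContinuousOnInterval f c d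

/-- The Legendre differential expression
`f'' + cot θ f' + ((ν + 1) ν - μ² / sin² θ) f`. -/
def legendreExpr (μ ν : ℝ) (f : ℝ → ℂ) (θ : ℝ) : ℂ :=
  deriv (deriv f) θ + (Real.cot θ : ℂ) * deriv f θ
    + (((ν + 1) * ν - μ ^ 2 / Real.sin θ ^ 2 : ℝ) : ℂ) * f θ

/-- `f` is a regular representative of the class `u ∈ L²`: it is differentiable on `(0, π)`,
`f' ∈ AC_loc(0, π)`, and the Legendre expression of `f` is in `L²`.
The values of `f` outside `(0, π)` play no role. -/
structure IsRegularRep (μ ν : ℝ) (u : L2sin) (f : ℝ → ℂ) : Prop where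
  ae_eq : u =ᵐ[sinMeasure] f
  diff : DifferentiableOn ℝ f (Ioo 0 Real.pi)
  ac : ACLoc (deriv f)
  memLp : MemLp (legendreExpr μ ν f) 2 sinMeasure

theorem sinMeasure_ac : sinMeasure ≪ volume.restrict (Ioo 0 Real.pi) :=
  withDensity_absolutelyContinuous _ _

theorem ac_sinMeasure : volume.restrict (Ioo 0 Real.pi) ≪ sinMeasure := by
  refine withDensity_absolutelyContinuous' ?_ ?_
  · exact (Real.measurable_sin.ennreal_ofReal).aemeasurable
  · filter_upwards [ae_restrict_mem measurableSet_Ioo] with θ hθ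
    simpa using Real.sin_pos_of_mem_Ioo hθ

theorem ae_sinMeasure_mem : ∀ᵐ θ ∂sinMeasure, θ ∈ Ioo 0 Real.pi :=
  sinMeasure_ac.ae_le (ae_restrict_mem measurableSet_Ioo)

theorem ACLoc.ae_differentiableAt {f : ℝ → ℂ} (hf : ACLoc f) :
    ∀ᵐ θ ∂sinMeasure, DifferentiableAt ℝ f θ := by
  refine sinMeasure_ac.ae_le ?_
  have hb : LocallyBoundedVariationOn f (Ioo 0 Real.pi) := by
    intro a b ha hb
    rcases le_or_gt a b with hab | hab
    · have h := (hf a b ha.1 hab hb.2).boundedVariationOn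
      rw [uIcc_of_le hab] at h
      exact h.mono inter_subset_right
    · simp [BoundedVariationOn, Icc_eq_empty (not_le.2 hab)]
  have h := hb.ae_differentiableWithinAt_of_mem
  refine (ae_restrict_iff' measurableSet_Ioo).2 ?_
  filter_upwards [h] with θ hθ hm
  exact (hθ hm).differentiableAt (Ioo_mem_nhds hm.1 hm.2)

theorem IsRegularRep.eqOn {μ ν : ℝ} {u : L2sin} {f g : ℝ → ℂ}
    (hf : IsRegularRep μ ν u f) (hg : IsRegularRep μ ν u g) : EqOn f g (Ioo 0 Real.pi) :=
  Measure.eqOn_open_of_ae_eq (ac_sinMeasure.ae_le (hf.ae_eq.symm.trans hg.ae_eq)) isOpen_Ioo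
    hf.diff.continuousOn hg.diff.continuousOn

theorem deriv_eqOn {f g : ℝ → ℂ} (h : EqOn f g (Ioo 0 Real.pi)) :
    EqOn (deriv f) (deriv g) (Ioo 0 Real.pi) := fun _ hθ =>
  Filter.EventuallyEq.deriv_eq (h.eventuallyEq_of_mem (Ioo_mem_nhds hθ.1 hθ.2))

theorem legendreExpr_eqOn (μ ν : ℝ) {f g : ℝ → ℂ} (h : EqOn f g (Ioo 0 Real.pi)) :
    EqOn (legendreExpr μ ν f) (legendreExpr μ ν g) (Ioo 0 Real.pi) := fun θ hθ => by
  simp only [legendreExpr, h hθ, deriv_eqOn h hθ, deriv_eqOn (deriv_eqOn h) hθ]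

theorem deriv_add_eqOn {f g : ℝ → ℂ} (hf : DifferentiableOn ℝ f (Ioo 0 Real.pi))
    (hg : DifferentiableOn ℝ g (Ioo 0 Real.pi)) :
    EqOn (deriv (f + g)) (deriv f + deriv g) (Ioo 0 Real.pi) := fun θ hθ => by
  have hn := Ioo_mem_nhds hθ.1 hθ.2
  exact deriv_add (hf.differentiableAt hn) (hg.differentiableAt hn)

theorem deriv_const_smul_eq (c : ℂ) (f : ℝ → ℂ) : deriv (c • f) = c • deriv f := by
  funext _
  exact deriv_const_smul_field c f

theorem ACLoc.congr {f g : ℝ → ℂ} (hf : ACLoc f) (h : EqOn f g (Ioo 0 Real.pi)) : ACLoc g := by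
  intro c d hc hcd hd
  refine Tendsto.congr' ?_ (hf c d hc hcd hd)
  refine Filter.eventually_inf_principal.2 (Filter.Eventually.of_forall fun E hE => ?_)
  refine Finset.sum_congr rfl fun i hi => ?_
  have hs : ∀ x ∈ uIcc c d, x ∈ Ioo 0 Real.pi := by
    intro x hx
    rw [uIcc_of_le hcd] at hx
    exact ⟨hc.trans_le hx.1, hx.2.trans_lt hd⟩
  rw [h (hs _ (hE.1 i hi).1), h (hs _ (hE.1 i hi).2)]

theorem legendreExpr_add_ae (μ ν : ℝ) {f g : ℝ → ℂ} (hf : DifferentiableOn ℝ f (Ioo 0 Real.pi))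
    (hg : DifferentiableOn ℝ g (Ioo 0 Real.pi)) (hf' : ACLoc (deriv f)) (hg' : ACLoc (deriv g)) :
    legendreExpr μ ν (f + g) =ᵐ[sinMeasure] legendreExpr μ ν f + legendreExpr μ ν g := by
  filter_upwards [ae_sinMeasure_mem, hf'.ae_differentiableAt, hg'.ae_differentiableAt]
    with θ hθ h1 h2
  have hd := deriv_add_eqOn hf hg
  have h3 : deriv (deriv (f + g)) θ = deriv (deriv f) θ + deriv (deriv g) θ := by
    rw [deriv_eqOn hd hθ, deriv_add h1 h2]
  have h4 : deriv (f + g) θ = deriv f θ + deriv g θ := hd hθ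
  simp only [legendreExpr, Pi.add_apply, h3, h4]
  ring

theorem legendreExpr_smul (μ ν : ℝ) (c : ℂ) (f : ℝ → ℂ) :
    legendreExpr μ ν (c • f) = c • legendreExpr μ ν f := by
  funext θ
  simp only [legendreExpr, deriv_const_smul_eq, Pi.smul_apply, smul_eq_mul]
  ring

theorem IsRegularRep.zero (μ ν : ℝ) : IsRegularRep μ ν 0 0 where
  ae_eq := Lp.coeFn_zero _ _ _
  diff := differentiableOn_const (0 : ℂ)
  ac := by
    intro c d _ _ _
    have h : deriv (0 : ℝ → ℂ) = fun _ => 0 := by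
      funext θ
      exact deriv_const θ (0 : ℂ)
    rw [h]
    simpa [AbsolutelyContinuousOnInterval] using tendsto_const_nhds
  memLp := by
    have h : legendreExpr μ ν 0 = 0 := by
      have := legendreExpr_smul μ ν 0 0
      simpa using this
    rw [h]
    exact MemLp.zero

theorem IsRegularRep.add {μ ν : ℝ} {u v : L2sin} {f g : ℝ → ℂ}
    (hf : IsRegularRep μ ν u f) (hg : IsRegularRep μ ν v g) :
    IsRegularRep μ ν (u + v) (f + g) where
  ae_eq := (Lp.coeFn_add u v).trans (hf.ae_eq.add hg.ae_eq)
  diff := hf.diff.add hg.diff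
  ac := by
    refine ACLoc.congr (f := deriv f + deriv g) ?_ (deriv_add_eqOn hf.diff hg.diff).symm
    exact fun c d h1 h2 h3 => (hf.ac c d h1 h2 h3).add (hg.ac c d h1 h2 h3)
  memLp := (memLp_congr_ae (legendreExpr_add_ae μ ν hf.diff hg.diff hf.ac hg.ac)).2
    (hf.memLp.add hg.memLp)

theorem IsRegularRep.smul {μ ν : ℝ} {u : L2sin} {f : ℝ → ℂ} (c : ℂ)
    (hf : IsRegularRep μ ν u f) : IsRegularRep μ ν (c • u) (c • f) where
  ae_eq := (Lp.coeFn_smul c u).trans (hf.ae_eq.const_smul c)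
  diff := hf.diff.const_smul c
  ac := by
    rw [deriv_const_smul_eq]
    exact fun a b h1 h2 h3 => (hf.ac a b h1 h2 h3).const_smul c
  memLp := by
    rw [legendreExpr_smul]
    exact hf.memLp.const_smul c

/-- The maximal domain
`D_max = {u ∈ L² : u' ∈ AC_loc(0, π), L u ∈ L²}` of the Legendre operator. -/
def Dmax (μ ν : ℝ) : Submodule ℂ L2sin where
  carrier := {u | ∃ f, IsRegularRep μ ν u f}
  zero_mem' := ⟨0, IsRegularRep.zero μ ν⟩
  add_mem' := fun ⟨f, hf⟩ ⟨g, hg⟩ => ⟨f + g, hf.add hg⟩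
  smul_mem' := fun c _ ⟨f, hf⟩ => ⟨c • f, hf.smul c⟩

/-- The class in `L²` of the Legendre expression of the regular representative of `u`. -/
def legendreFun (μ ν : ℝ) (u : Dmax μ ν) : L2sin :=
  (Classical.choose_spec u.2).memLp.toLp _

/-- The Legendre operator may be computed from any regular representative. -/
theorem legendreFun_eq {μ ν : ℝ} (u : Dmax μ ν) {f : ℝ → ℂ} (hf : IsRegularRep μ ν u f) :
    legendreFun μ ν u = hf.memLp.toLp _ := by
  refine MemLp.toLp_congr _ _ ?_
  filter_upwards [ae_sinMeasure_mem] with θ hθ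
  exact legendreExpr_eqOn μ ν ((Classical.choose_spec u.2).eqOn hf) hθ

/-- The Legendre operator on its maximal domain, as an unbounded operator on `L²`. -/
def legendreMax (μ ν : ℝ) : L2sin →ₗ.[ℂ] L2sin where
  domain := Dmax μ ν
  toFun :=
    { toFun := legendreFun μ ν
      map_add' := fun u v => by
        obtain ⟨f, hf⟩ := u.2
        obtain ⟨g, hg⟩ := v.2
        rw [legendreFun_eq u hf, legendreFun_eq v hg, legendreFun_eq (u + v) (hf.add hg),
          ← MemLp.toLp_add]
        exact MemLp.toLp_congr _ _ (legendreExpr_add_ae μ ν hf.diff hg.diff hf.ac hg.ac)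
      map_smul' := fun c u => by
        obtain ⟨f, hf⟩ := u.2
        rw [legendreFun_eq u hf, legendreFun_eq (c • u) (hf.smul c), RingHom.id_apply,
          ← MemLp.toLp_const_smul]
        exact MemLp.toLp_congr _ _ (Eventually.of_forall fun θ => by
          rw [legendreExpr_smul]) }

/-- The boundary quantity `sin^{2n+1} θ · d/dθ (f / sin^n θ)`. -/
def bdryQuantity (n : ℝ) (f : ℝ → ℂ) (θ : ℝ) : ℂ :=
  ((Real.sin θ ^ (2 * n + 1) : ℝ) : ℂ) *
    deriv (fun t : ℝ => f t / ((Real.sin t ^ n : ℝ) : ℂ)) θ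

/-- The separated boundary conditions: the boundary quantity tends to `0` at `0` and at `π`. -/
def SeparatedBC (n : ℝ) (f : ℝ → ℂ) : Prop :=
  Tendsto (bdryQuantity n f) (𝓝[>] 0) (𝓝 0) ∧
    Tendsto (bdryQuantity n f) (𝓝[<] Real.pi) (𝓝 0)

theorem differentiableAt_div_sin_rpow (n : ℝ) {f : ℝ → ℂ} {θ : ℝ} (hθ : θ ∈ Ioo 0 Real.pi)
    (hf : DifferentiableOn ℝ f (Ioo 0 Real.pi)) :
    DifferentiableAt ℝ (fun t : ℝ => f t / ((Real.sin t ^ n : ℝ) : ℂ)) θ := by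
  have hs := Real.sin_pos_of_mem_Ioo hθ
  have h1 : DifferentiableAt ℝ (fun t : ℝ => Real.sin t ^ n) θ :=
    Real.differentiableAt_sin.rpow_const (Or.inl hs.ne')
  have h2 : DifferentiableAt ℝ (fun t : ℝ => ((Real.sin t ^ n : ℝ) : ℂ)) θ :=
    h1.hasDerivAt.ofReal_comp.differentiableAt
  refine (hf.differentiableAt (Ioo_mem_nhds hθ.1 hθ.2)).div h2 ?_
  exact_mod_cast (Real.rpow_pos_of_pos hs n).ne'

theorem bdryQuantity_add (n : ℝ) {f g : ℝ → ℂ} (hf : DifferentiableOn ℝ f (Ioo 0 Real.pi))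
    (hg : DifferentiableOn ℝ g (Ioo 0 Real.pi)) {θ : ℝ} (hθ : θ ∈ Ioo 0 Real.pi) :
    bdryQuantity n (f + g) θ = bdryQuantity n f θ + bdryQuantity n g θ := by
  have h := deriv_add (differentiableAt_div_sin_rpow n hθ hf)
    (differentiableAt_div_sin_rpow n hθ hg)
  have h' : (fun t : ℝ => (f + g) t / ((Real.sin t ^ n : ℝ) : ℂ)) =
      (fun t : ℝ => f t / ((Real.sin t ^ n : ℝ) : ℂ)) +
        fun t : ℝ => g t / ((Real.sin t ^ n : ℝ) : ℂ) := by
    funext t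
    simp [add_div]
  simp only [bdryQuantity]
  rw [h', h, mul_add]

theorem bdryQuantity_smul (n : ℝ) (c : ℂ) (f : ℝ → ℂ) :
    bdryQuantity n (c • f) = fun θ => c * bdryQuantity n f θ := by
  funext θ
  have h' : (fun t : ℝ => (c • f) t / ((Real.sin t ^ n : ℝ) : ℂ)) =
      c • fun t : ℝ => f t / ((Real.sin t ^ n : ℝ) : ℂ) := by
    funext t
    simp [mul_div_assoc]
  simp only [bdryQuantity]
  rw [h', deriv_const_smul_eq]
  simp only [Pi.smul_apply, smul_eq_mul]
  ring

theorem SeparatedBC.add {n : ℝ} {f g : ℝ → ℂ} (hf : DifferentiableOn ℝ f (Ioo 0 Real.pi))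
    (hg : DifferentiableOn ℝ g (Ioo 0 Real.pi)) (bf : SeparatedBC n f) (bg : SeparatedBC n g) :
    SeparatedBC n (f + g) := by
  have h0 := bf.1.add bg.1
  have h1 := bf.2.add bg.2
  rw [add_zero] at h0 h1
  refine ⟨h0.congr' ?_, h1.congr' ?_⟩
  · filter_upwards [Ioo_mem_nhdsGT Real.pi_pos] with θ hθ
    exact (bdryQuantity_add n hf hg hθ).symm
  · filter_upwards [Ioo_mem_nhdsLT Real.pi_pos] with θ hθ
    exact (bdryQuantity_add n hf hg hθ).symm

theorem SeparatedBC.smul {n : ℝ} {f : ℝ → ℂ} (c : ℂ) (bf : SeparatedBC n f) :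
    SeparatedBC n (c • f) := by
  unfold SeparatedBC
  rw [bdryQuantity_smul]
  exact ⟨by simpa using bf.1.const_mul c, by simpa using bf.2.const_mul c⟩

theorem SeparatedBC.zero (n : ℝ) : SeparatedBC n 0 := by
  have h : bdryQuantity n 0 = fun _ => 0 := by
    funext θ
    simp [bdryQuantity]
  unfold SeparatedBC
  rw [h]
  exact ⟨tendsto_const_nhds, tendsto_const_nhds⟩

/-- `D_SA`: the elements of the maximal domain of the Legendre operator with `μ = ν = n` whose
regular representative (unique on `(0, π)`) satisfies the separated boundary conditions. -/
def DSA (n : ℝ) : Submodule ℂ L2sin where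
  carrier := {u | ∃ f, IsRegularRep n n u f ∧ SeparatedBC n f}
  zero_mem' := ⟨0, IsRegularRep.zero n n, SeparatedBC.zero n⟩
  add_mem' := fun ⟨f, hf, bf⟩ ⟨g, hg, bg⟩ =>
    ⟨f + g, hf.add hg, SeparatedBC.add hf.diff hg.diff bf bg⟩
  smul_mem' := fun c _ ⟨f, hf, bf⟩ => ⟨c • f, hf.smul c, bf.smul c⟩

/-- Astigmatism `C₀ sin^{2n+2} θ` of a linear Hopf sphere. -/
def hopfAstigmatism (C₀ n θ : ℝ) : ℝ := C₀ * Real.sin θ ^ (2 * n + 2)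

/-- The stationary profile `s_Hopf / sin^{n+2} θ`, which is `C₀ sin^n θ` on `(0, π)`. -/
def hopfProfile (C₀ n θ : ℝ) : ℂ :=
  ((hopfAstigmatism C₀ n θ / Real.sin θ ^ (n + 2) : ℝ) : ℂ)

theorem hopfProfile_eq (C₀ n : ℝ) {θ : ℝ} (hθ : θ ∈ Ioo 0 Real.pi) :
    hopfProfile C₀ n θ = ((C₀ * Real.sin θ ^ n : ℝ) : ℂ) := by
  have hs := Real.sin_pos_of_mem_Ioo hθ
  unfold hopfProfile hopfAstigmatism
  rw [mul_div_assoc, ← Real.rpow_sub hs]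
  ring_nf

end LegendreSL

end

/-! Everything rests on the factorization `sin^{n+1} L f = P'` with `P = sin^{2n+1} (f / sin^n)'`,
where `P` is the boundary quantity. In particular `L` annihilates `k = sin^n`, which lies in the
weighted space because `n > -1`, and whose boundary quantity is identically zero.

For `f` in the domain, `P` vanishes at both endpoints, so it is the primitive of `sin^{n+1} L f`
from either end. Cauchy–Schwarz with `L f ∈ L²` then gives `P = O(sin^{n+1})`
(`exists_norm_integral_le`). Hence `(f / sin^n)' = O(sin^{-n})`, which is integrable because `n <
1`, and `f / sin^n` is bounded (`exists_bound_of_deriv_bound`). The weighted Wronskian of `f` and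
`g` is `conj P_f · (g / sin^n) - conj (f / sin^n) · P_g`, a combination of bounded factors with
factors tending to zero. Its boundary values therefore vanish, and the operator is symmetric.

The same estimates solve `L f = h` whenever `h` is orthogonal to `k`: integrate the factored
equation twice. Orthogonality is exactly the condition that the first primitive, which starts from
zero at `0`, also vanishes at `π`.

A symmetric operator that kills `k` and whose range contains the orthogonal complement of `k` is
self-adjoint. This is a Hilbert space fact (`LinearPMap.isSelfAdjoint_of_range_orthogonal_ker`), and
it also yields density of the domain.

Second derivatives exist only almost everywhere, so each integration uses the fundamental theorem of
calculus for absolutely continuous functions. -/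

noncomputable section

/-! ### An abstract criterion for self-adjointness -/

/-- A symmetric operator that annihilates a vector `k` of its domain and whose range contains every
vector orthogonal to `k` is self-adjoint. -/
theorem LinearPMap.isSelfAdjoint_of_range_orthogonal_ker {E : Type*} [NormedAddCommGroup E]
    [InnerProductSpace ℂ E] [CompleteSpace E] (T : E →ₗ.[ℂ] E) (hT : T.IsFormalAdjoint T)
    (k : T.domain) (hk : T k = 0)
    (hrange : ∀ h : E, inner ℂ (k : E) h = 0 → ∃ u : T.domain, T u = h) : IsSelfAdjoint T := by
  -- The range contains the orthogonal complement of `k`, so a vector orthogonal to the range lies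
  -- in the double complement of the line through `k`, which is that line.
  have hspan : ∀ v : E, (∀ x : T.domain, inner ℂ v (T x) = 0) → ∃ c : ℂ, v = c • (k : E) := by
    intro v hv
    have hmem : v ∈ (ℂ ∙ (k : E))ᗮᗮ := by
      rw [Submodule.mem_orthogonal']
      intro h hh
      obtain ⟨u, rfl⟩ := hrange h (Submodule.mem_orthogonal_singleton_iff_inner_right.1 hh)
      exact hv u
    rw [Submodule.orthogonal_orthogonal, Submodule.mem_span_singleton] at hmem
    obtain ⟨c, hc⟩ := hmem
    exact ⟨c, hc.symm⟩
  -- A vector orthogonal to the domain is orthogonal to `k`, hence equals `T u`. By symmetry `u` is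
  -- orthogonal to the range, so `u` is a multiple of `k` and `T u = 0`.
  have hdense : Dense (T.domain : Set E) := by
    rw [Submodule.dense_iff_topologicalClosure_eq_top, Submodule.topologicalClosure_eq_top_iff,
      Submodule.eq_bot_iff]
    intro v hv
    rw [Submodule.mem_orthogonal] at hv
    obtain ⟨u, rfl⟩ := hrange v (hv k k.2)
    obtain ⟨c, hc⟩ := hspan u fun x => by
      rw [← hT u x, ← inner_conj_symm, hv x x.2]; simp
    have : u = c • k := Subtype.ext hc
    rw [this, T.map_smul, hk, smul_zero]
  rw [LinearPMap.isSelfAdjoint_def]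
  have hle := hT.le_adjoint hdense
  refine (LinearPMap.eq_of_le_of_domain_eq hle (le_antisymm hle.1 fun v hv => ?_)).symm
  have hadj : ∀ x : T.domain, inner ℂ (T.adjoint ⟨v, hv⟩) (x : E) = inner ℂ v (T x) := fun x =>
    LinearPMap.adjoint_isFormalAdjoint hdense ⟨v, hv⟩ x
  -- The vector `T* v` is orthogonal to `k` because `T k = 0`, so `T* v = T u` for some `u` in the
  -- domain. Then `v - u` is orthogonal to the range, hence a multiple of `k`, and `v` is in the
  -- domain.
  obtain ⟨u, hu⟩ := hrange (T.adjoint ⟨v, hv⟩) (by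
    rw [← inner_conj_symm, hadj k, hk, inner_zero_right]; simp)
  obtain ⟨c, hc⟩ := hspan (v - u) fun x => by
    rw [inner_sub_left, ← hadj x, ← hu, hT u x, sub_self]
  rw [sub_eq_iff_eq_add.1 hc]
  exact T.domain.add_mem (T.domain.smul_mem c k.2) u.2

/-! ### Complex-valued absolutely continuous functions -/

namespace AbsolutelyContinuousOnInterval

theorem comp_lipschitzWith {X Y : Type*} [PseudoMetricSpace X] [PseudoMetricSpace Y] {f : ℝ → X}
    {a b : ℝ} (hf : AbsolutelyContinuousOnInterval f a b) {K : NNReal} {L : X → Y}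
    (hL : LipschitzWith K L) : AbsolutelyContinuousOnInterval (fun x => L (f x)) a b := by
  refine squeeze_zero (fun E => Finset.sum_nonneg fun i _ => dist_nonneg) (fun E => ?_)
    (by simpa using Tendsto.const_mul (K : ℝ) hf)
  rw [Finset.mul_sum]
  exact Finset.sum_le_sum fun i _ => hL.dist_le_mul _ _

theorem congr {X : Type*} [PseudoMetricSpace X] {f g : ℝ → X} {a b : ℝ}
    (hf : AbsolutelyContinuousOnInterval f a b) (h : EqOn f g (uIcc a b)) :
    AbsolutelyContinuousOnInterval g a b := by
  refine Tendsto.congr' ?_ hf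
  refine Filter.eventually_inf_principal.2 (Filter.Eventually.of_forall fun E hE => ?_)
  refine Finset.sum_congr rfl fun i hi => ?_
  rw [h (hE.1 i hi).1, h (hE.1 i hi).2]

/-- Reduces to the real case: the real and imaginary parts of the primitive are primitives of
integrable real functions. -/
theorem intervalIntegral_complex {f : ℝ → ℂ} {a b c : ℝ} (h : IntervalIntegrable f volume a b)
    (hc : c ∈ uIcc a b) : AbsolutelyContinuousOnInterval (fun x => ∫ t in c..x, f t) a b := by
  have hre : IntervalIntegrable (fun t => (f t).re) volume a b := ⟨h.1.re, h.2.re⟩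
  have him : IntervalIntegrable (fun t => (f t).im) volume a b := ⟨h.1.im, h.2.im⟩
  have h1 := (hre.absolutelyContinuousOnInterval_intervalIntegral hc).comp_lipschitzWith
    Complex.ofRealCLM.lipschitz
  have h2 := ((him.absolutelyContinuousOnInterval_intervalIntegral hc).comp_lipschitzWith
    Complex.ofRealCLM.lipschitz).const_smul Complex.I
  refine (h1.add h2).congr fun x hx => ?_
  have hx := h.mono_set (uIcc_subset_uIcc hc hx)
  have e1 := Complex.reCLM.intervalIntegral_comp_comm hx
  have e2 := Complex.imCLM.intervalIntegral_comp_comm hx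
  simp only [Complex.reCLM_apply, Complex.imCLM_apply] at e1 e2
  simp only [Pi.add_apply, Complex.ofRealCLM_apply, smul_eq_mul, e1, e2]
  rw [mul_comm Complex.I, Complex.re_add_im]

/-- Subtracting the primitive of `f'` from `f` leaves an absolutely continuous function with zero
derivative almost everywhere, hence a constant. -/
theorem integral_eq_sub_of_ae_hasDerivAt {f f' : ℝ → ℂ} {a b : ℝ}
    (hf : AbsolutelyContinuousOnInterval f a b) (hint : IntervalIntegrable f' volume a b)
    (hd : ∀ᵐ x, x ∈ uIcc a b → HasDerivAt f (f' x) x) : ∫ x in a..b, f' x = f b - f a := by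
  have h1 := hf.sub (intervalIntegral_complex hint left_mem_uIcc)
  obtain ⟨C, hC⟩ := h1.const_of_ae_hasDerivAt_zero (by
    filter_upwards [hd, hint.ae_hasDerivAt_integral] with x h2 h3 hx
    simpa using (h2 hx).sub (h3 hx a left_mem_uIcc))
  have ha := hC a left_mem_uIcc
  have hb := hC b right_mem_uIcc
  simp only [Pi.sub_apply, intervalIntegral.integral_same, sub_zero] at ha hb
  rw [ha, ← hb]
  ring

end AbsolutelyContinuousOnInterval

/-! ### Powers of the sine and weighted Cauchy–Schwarz estimates -/

namespace LegendreSL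

/-- Isolates the endpoint singularity `t ^ a`; the remaining factor is continuous up to `0`, since
`sinc` is positive on the closed half interval. -/
theorem sin_rpow_eq {a t : ℝ} (h0 : 0 ≤ t) (h1 : t ≤ Real.pi / 2) :
    Real.sin t ^ a = t ^ a * Real.sinc t ^ a := by
  rcases h0.eq_or_lt with rfl | h
  · simp
  · rw [← Real.mul_rpow h0, Real.sinc_of_ne_zero h.ne', mul_div_cancel₀ _ h.ne']
    rw [Real.sinc_of_ne_zero h.ne']
    exact div_nonneg (Real.sin_nonneg_of_nonneg_of_le_pi h0 (by linarith [Real.pi_pos])) h0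

theorem sinc_pos_of_le_pi_div_two {t : ℝ} (h0 : 0 ≤ t) (h1 : t ≤ Real.pi / 2) :
    0 < Real.sinc t := by
  rcases h0.eq_or_lt with rfl | h
  · simp
  · rw [Real.sinc_of_ne_zero h.ne']
    exact div_pos (Real.sin_pos_of_pos_of_lt_pi h (by linarith [Real.pi_pos])) h

theorem continuousOn_sinc_rpow (a : ℝ) :
    ContinuousOn (fun t => Real.sinc t ^ a) (Icc 0 (Real.pi / 2)) :=
  Real.continuous_sinc.continuousOn.rpow_const fun _ ht =>
    Or.inl (sinc_pos_of_le_pi_div_two ht.1 ht.2).ne'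

theorem intervalIntegrable_sin_rpow {a : ℝ} (ha : -1 < a) :
    IntervalIntegrable (fun t => Real.sin t ^ a) volume 0 Real.pi := by
  have hp : (0 : ℝ) ≤ Real.pi / 2 := by positivity
  have h1 : IntervalIntegrable (fun t => Real.sin t ^ a) volume 0 (Real.pi / 2) := by
    have h := (intervalIntegral.intervalIntegrable_rpow' (a := 0) (b := Real.pi / 2)
      ha).mul_continuousOn (g := fun t => Real.sinc t ^ a)
      (by rw [uIcc_of_le hp]; exact continuousOn_sinc_rpow a)
    refine h.congr fun t ht => ?_
    rw [uIoc_of_le hp] at ht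
    exact (sin_rpow_eq ht.1.le ht.2).symm
  refine h1.trans ?_
  have h2 := h1.comp_sub_left Real.pi
  simp only [Real.sin_pi_sub, sub_zero] at h2
  rw [show Real.pi - Real.pi / 2 = Real.pi / 2 by ring] at h2
  exact h2.symm

/-- Bounding `sinc ^ a` by a constant leaves the integral of `t ^ a`, and Jordan's inequality `θ ≤
(π / 2) sin θ` turns the resulting power of `θ` back into a power of the sine. -/
theorem exists_integral_sin_rpow_le {a : ℝ} (ha : -1 < a) :
    ∃ K, ∀ θ, 0 < θ → θ ≤ Real.pi / 2 →
      ∫ t in (0 : ℝ)..θ, Real.sin t ^ a ≤ K * Real.sin θ ^ (a + 1) := by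
  obtain ⟨K, hK⟩ := isCompact_Icc.exists_bound_of_continuousOn (continuousOn_sinc_rpow a)
  have hK0 : 0 ≤ K := (norm_nonneg _).trans (hK 0 ⟨le_rfl, by positivity⟩)
  refine ⟨K * ((Real.pi / 2) ^ (a + 1) / (a + 1)), fun θ h0 h1 => ?_⟩
  have hs : 0 < Real.sin θ := Real.sin_pos_of_pos_of_lt_pi h0 (by linarith [Real.pi_pos])
  have hsub : uIcc 0 θ ⊆ uIcc 0 Real.pi := by
    rw [uIcc_of_le h0.le, uIcc_of_le Real.pi_pos.le]
    exact Icc_subset_Icc_right (by linarith [Real.pi_pos])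
  calc ∫ t in (0 : ℝ)..θ, Real.sin t ^ a ≤ ∫ t in (0 : ℝ)..θ, K * t ^ a := by
        refine intervalIntegral.integral_mono_on h0.le
          ((intervalIntegrable_sin_rpow ha).mono_set hsub)
          ((intervalIntegral.intervalIntegrable_rpow' ha).const_mul K) fun t ht => ?_
        rw [sin_rpow_eq ht.1 (ht.2.trans h1), mul_comm]
        exact mul_le_mul_of_nonneg_right
          ((le_abs_self _).trans (hK t ⟨ht.1, ht.2.trans h1⟩)) (Real.rpow_nonneg ht.1 _)
    _ = K * (θ ^ (a + 1) / (a + 1)) := by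
        rw [intervalIntegral.integral_const_mul, integral_rpow (Or.inl ha),
          Real.zero_rpow (by linarith), sub_zero]
    _ ≤ K * ((Real.pi / 2 * Real.sin θ) ^ (a + 1) / (a + 1)) := by
        have h2 : θ ≤ Real.pi / 2 * Real.sin θ := by
          have h3 := Real.mul_le_sin h0.le h1
          calc θ = Real.pi / 2 * (2 / Real.pi * θ) := by field_simp
            _ ≤ _ := by gcongr
        have h4 : 0 < a + 1 := by linarith
        gcongr
    _ = _ := by
        rw [Real.mul_rpow (by positivity) hs.le]
        ring

/-- The Cauchy–Schwarz bound for `∫ sin^{n+1} φ` near the left endpoint. -/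
theorem exists_norm_integral_le_near_zero {n : ℝ} (hn : -1 < n) {φ : ℝ → ℂ}
    (h1 : IntervalIntegrable (fun t => ((Real.sin t ^ (n + 1) : ℝ) : ℂ) * φ t) volume 0 Real.pi)
    (h2 : IntervalIntegrable (fun t => Real.sin t * ‖φ t‖ ^ 2) volume 0 Real.pi) :
    ∃ C, ∀ θ, 0 < θ → θ ≤ Real.pi / 2 →
      ‖∫ t in (0 : ℝ)..θ, ((Real.sin t ^ (n + 1) : ℝ) : ℂ) * φ t‖ ≤ C * Real.sin θ ^ (n + 1) := by
  obtain ⟨K, hK⟩ := exists_integral_sin_rpow_le (a := 2 * n + 1) (by linarith)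
  set M := ∫ t in (0 : ℝ)..Real.pi, Real.sin t * ‖φ t‖ ^ 2 with hM
  refine ⟨2⁻¹ * (K + M), fun θ h0 hθ => ?_⟩
  have hs : 0 < Real.sin θ := Real.sin_pos_of_pos_of_lt_pi h0 (by linarith [Real.pi_pos])
  have hsub : uIcc 0 θ ⊆ uIcc 0 Real.pi := by
    rw [uIcc_of_le h0.le, uIcc_of_le Real.pi_pos.le]
    exact Icc_subset_Icc_right (by linarith [Real.pi_pos])
  -- Cauchy–Schwarz in the form `2ab ≤ ε⁻¹ a² + ε b²`. Since the integral of `sin^{2n+1}` is at most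
  -- `K ε²`, this choice of `ε` makes both terms of order `ε`.
  set ε := Real.sin θ ^ (n + 1) with hε
  have hε0 : 0 < ε := Real.rpow_pos_of_pos hs _
  have hi := (intervalIntegrable_sin_rpow (a := 2 * n + 1) (by linarith)).mono_set hsub
  have h2' := h2.mono_set hsub
  have hM' : ∫ t in (0 : ℝ)..θ, Real.sin t * ‖φ t‖ ^ 2 ≤ M := by
    refine intervalIntegral.integral_mono_interval le_rfl h0.le (by linarith [Real.pi_pos]) ?_ h2
    filter_upwards [ae_restrict_mem measurableSet_Ioc] with t ht
    exact mul_nonneg (Real.sin_nonneg_of_nonneg_of_le_pi ht.1.le ht.2) (sq_nonneg _)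
  calc ‖∫ t in (0 : ℝ)..θ, ((Real.sin t ^ (n + 1) : ℝ) : ℂ) * φ t‖
      ≤ ∫ t in (0 : ℝ)..θ, ‖((Real.sin t ^ (n + 1) : ℝ) : ℂ) * φ t‖ :=
        intervalIntegral.norm_integral_le_integral_norm h0.le
    _ ≤ ∫ t in (0 : ℝ)..θ, 2⁻¹ * (ε⁻¹ * Real.sin t ^ (2 * n + 1)
          + ε * (Real.sin t * ‖φ t‖ ^ 2)) := by
        refine intervalIntegral.integral_mono_on_of_le_Ioo h0.le (h1.mono_set hsub).norm
          (((hi.const_mul _).add (h2'.const_mul _)).const_mul _) fun t ht => ?_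
        have hst : 0 < Real.sin t :=
          Real.sin_pos_of_pos_of_lt_pi ht.1 (by linarith [Real.pi_pos, ht.2])
        have e1 : Real.sin t ^ (n + 1) = Real.sin t ^ n * Real.sin t := Real.rpow_add_one hst.ne' n
        have e2 : Real.sin t ^ (2 * n + 1) = (Real.sin t ^ n) ^ 2 * Real.sin t := by
          rw [Real.rpow_add_one hst.ne', mul_comm 2 n, Real.rpow_mul hst.le, Real.rpow_ofNat]
        rw [norm_mul, Complex.norm_real, Real.norm_of_nonneg (Real.rpow_nonneg hst.le _), e1, e2]
        have h3 : 0 ≤ 2⁻¹ * ε⁻¹ * Real.sin t * (Real.sin t ^ n - ε * ‖φ t‖) ^ 2 := by positivity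
        have h4 : 2⁻¹ * (ε⁻¹ * ((Real.sin t ^ n) ^ 2 * Real.sin t)
            + ε * (Real.sin t * ‖φ t‖ ^ 2)) - Real.sin t ^ n * Real.sin t * ‖φ t‖
            = 2⁻¹ * ε⁻¹ * Real.sin t * (Real.sin t ^ n - ε * ‖φ t‖) ^ 2 := by
          field_simp
          ring
        linarith
    _ = 2⁻¹ * (ε⁻¹ * (∫ t in (0 : ℝ)..θ, Real.sin t ^ (2 * n + 1))
          + ε * ∫ t in (0 : ℝ)..θ, Real.sin t * ‖φ t‖ ^ 2) := by
        rw [intervalIntegral.integral_const_mul, intervalIntegral.integral_add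
          (hi.const_mul _) (h2'.const_mul _), intervalIntegral.integral_const_mul,
          intervalIntegral.integral_const_mul]
    _ ≤ 2⁻¹ * (ε⁻¹ * (K * ε ^ 2) + ε * M) := by
        have h3 := hK θ h0 hθ
        rw [show 2 * n + 1 + 1 = (n + 1) * 2 by ring, Real.rpow_mul hs.le, Real.rpow_ofNat] at h3
        gcongr
    _ = 2⁻¹ * (K + M) * ε := by
        field_simp

/-- A function `φ` whose weighted integral over `(0, π)` vanishes has primitive `O(sin^{n+1})`. -/
theorem exists_norm_integral_le {n : ℝ} (hn : -1 < n) {φ : ℝ → ℂ}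
    (h1 : IntervalIntegrable (fun t => ((Real.sin t ^ (n + 1) : ℝ) : ℂ) * φ t) volume 0 Real.pi)
    (h2 : IntervalIntegrable (fun t => Real.sin t * ‖φ t‖ ^ 2) volume 0 Real.pi)
    (h0 : ∫ t in (0 : ℝ)..Real.pi, ((Real.sin t ^ (n + 1) : ℝ) : ℂ) * φ t = 0) :
    ∃ C, ∀ θ ∈ Ioo 0 Real.pi,
      ‖∫ t in (0 : ℝ)..θ, ((Real.sin t ^ (n + 1) : ℝ) : ℂ) * φ t‖ ≤ C * Real.sin θ ^ (n + 1) := by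
  obtain ⟨C, hC⟩ := exists_norm_integral_le_near_zero hn h1 h2
  -- The reflection `t ↦ π - t` carries the estimate at `0` over to the other endpoint.
  have h1' := h1.comp_sub_left Real.pi
  have h2' := h2.comp_sub_left Real.pi
  simp only [Real.sin_pi_sub, sub_zero, sub_self] at h1' h2'
  obtain ⟨D, hD⟩ := exists_norm_integral_le_near_zero (φ := fun t => φ (Real.pi - t)) hn
    h1'.symm h2'.symm
  refine ⟨max C D, fun θ hθ => ?_⟩
  have hs : 0 ≤ Real.sin θ ^ (n + 1) := Real.rpow_nonneg (Real.sin_pos_of_mem_Ioo hθ).le _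
  rcases le_total θ (Real.pi / 2) with h | h
  · exact (hC θ hθ.1 h).trans (mul_le_mul_of_nonneg_right (le_max_left _ _) hs)
  · have h3 := hD (Real.pi - θ) (by linarith [hθ.2]) (by linarith)
    have h4 := intervalIntegral.integral_comp_sub_left (a := 0) (b := Real.pi - θ)
      (fun t => ((Real.sin t ^ (n + 1) : ℝ) : ℂ) * φ t) Real.pi
    simp only [Real.sin_pi_sub, sub_zero, sub_sub_cancel] at h4 h3
    rw [h4] at h3
    have hm : θ ∈ uIcc 0 Real.pi := by
      rw [uIcc_of_le Real.pi_pos.le]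
      exact ⟨hθ.1.le, hθ.2.le⟩
    -- As the total integral vanishes, the integral up to `θ` is minus the integral from `θ` to `π`,
    -- which the reflected estimate controls.
    have h5 := intervalIntegral.integral_add_adjacent_intervals
      (h1.mono_set (uIcc_subset_uIcc_left hm)) (h1.mono_set (uIcc_subset_uIcc_right hm))
    rw [h0] at h5
    rw [eq_neg_of_add_eq_zero_left h5, norm_neg]
    exact h3.trans (mul_le_mul_of_nonneg_right (le_max_right _ _) hs)

/-! ### Local absolute continuity on `(0, π)` -/

theorem Icc_subset_Ioo_pi {c d : ℝ} (hc : 0 < c) (hd : d < Real.pi) :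
    Icc c d ⊆ Ioo 0 Real.pi := fun _ hx => ⟨hc.trans_le hx.1, hx.2.trans_lt hd⟩

theorem ACLoc.of_contDiffOn {f : ℝ → ℂ} (hf : ContDiffOn ℝ 1 f (Ioo 0 Real.pi)) : ACLoc f := by
  intro c d hc hcd hd
  refine ContDiffOn.absolutelyContinuousOnInterval (hf.mono ?_)
  rw [uIcc_of_le hcd]
  exact Icc_subset_Ioo_pi hc hd

theorem ACLoc.of_continuousOn_deriv {f : ℝ → ℂ} (hf : DifferentiableOn ℝ f (Ioo 0 Real.pi))
    (hc : ContinuousOn (deriv f) (Ioo 0 Real.pi)) : ACLoc f := by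
  refine ACLoc.of_contDiffOn ?_
  rw [show (1 : WithTop ℕ∞) = 0 + 1 by norm_num, contDiffOn_succ_iff_deriv_of_isOpen isOpen_Ioo]
  exact ⟨hf, by simp, contDiffOn_zero.2 hc⟩

theorem ACLoc.continuousOn {f : ℝ → ℂ} (hf : ACLoc f) : ContinuousOn f (Ioo 0 Real.pi) := by
  intro θ hθ
  have h := (hf (θ / 2) ((θ + Real.pi) / 2) (by linarith [hθ.1]) (by linarith [hθ.1, hθ.2])
    (by linarith [hθ.2])).continuousOn
  rw [uIcc_of_le (by linarith [hθ.1, hθ.2])] at h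
  exact (h.continuousAt (Icc_mem_nhds (by linarith [hθ.1]) (by linarith [hθ.2]))).continuousWithinAt

theorem ACLoc.mul {f g : ℝ → ℂ} (hf : ACLoc f) (hg : ACLoc g) : ACLoc (fun t => f t * g t) :=
  fun c d h1 h2 h3 => (hf c d h1 h2 h3).smul (hg c d h1 h2 h3)

theorem ACLoc.add {f g : ℝ → ℂ} (hf : ACLoc f) (hg : ACLoc g) : ACLoc (fun t => f t + g t) :=
  fun c d h1 h2 h3 => AbsolutelyContinuousOnInterval.add (hf c d h1 h2 h3) (hg c d h1 h2 h3)

theorem ACLoc.sub {f g : ℝ → ℂ} (hf : ACLoc f) (hg : ACLoc g) : ACLoc (fun t => f t - g t) :=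
  fun c d h1 h2 h3 => AbsolutelyContinuousOnInterval.sub (hf c d h1 h2 h3) (hg c d h1 h2 h3)

theorem ACLoc.star {f : ℝ → ℂ} (hf : ACLoc f) : ACLoc (fun t => starRingEnd ℂ (f t)) :=
  fun c d h1 h2 h3 => (hf c d h1 h2 h3).comp_lipschitzWith Complex.conjCLE.lipschitz

theorem hasDerivAt_sin_rpow (a : ℝ) {θ : ℝ} (hθ : θ ∈ Ioo 0 Real.pi) :
    HasDerivAt (fun t => ((Real.sin t ^ a : ℝ) : ℂ))
      ((a * Real.sin θ ^ (a - 1) * Real.cos θ : ℝ) : ℂ) θ := by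
  have h := ((Real.hasDerivAt_sin θ).rpow_const (p := a)
    (Or.inl (Real.sin_pos_of_mem_Ioo hθ).ne')).ofReal_comp
  convert! h using 2
  ring

theorem contDiffOn_sin_rpow (a : ℝ) :
    ContDiffOn ℝ 1 (fun t => ((Real.sin t ^ a : ℝ) : ℂ)) (Ioo 0 Real.pi) := by
  have h : ContDiffOn ℝ 1 (fun t => Real.sin t ^ a) (Ioo 0 Real.pi) :=
    Real.contDiff_sin.contDiffOn.rpow_const_of_ne
      fun t ht => (Real.sin_pos_of_mem_Ioo ht).ne'
  exact Complex.ofRealCLM.contDiff.comp_contDiffOn h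

theorem continuousOn_sin_rpow (a : ℝ) :
    ContinuousOn (fun t => ((Real.sin t ^ a : ℝ) : ℂ)) (Ioo 0 Real.pi) :=
  (contDiffOn_sin_rpow a).continuousOn

theorem acLoc_sin_rpow (a : ℝ) : ACLoc (fun t => ((Real.sin t ^ a : ℝ) : ℂ)) :=
  .of_contDiffOn (contDiffOn_sin_rpow a)

theorem acLoc_cos : ACLoc (fun t => ((Real.cos t : ℝ) : ℂ)) :=
  .of_contDiffOn (Complex.ofRealCLM.contDiff.comp Real.contDiff_cos).contDiffOn

theorem acLoc_const (c : ℂ) : ACLoc (fun _ => c) := .of_contDiffOn contDiffOn_const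

theorem tendsto_primitive_zero {w : ℝ → ℂ} (hw : IntervalIntegrable w volume 0 Real.pi) :
    Tendsto (fun x => ∫ t in (0 : ℝ)..x, w t) (𝓝[>] 0) (𝓝 0) := by
  have h := intervalIntegral.continuousOn_primitive_interval' hw left_mem_uIcc
  have h1 := h 0 left_mem_uIcc
  rw [ContinuousWithinAt, intervalIntegral.integral_same] at h1
  refine h1.mono_left ?_
  rw [uIcc_of_le Real.pi_pos.le]
  exact nhdsWithin_le_of_mem
    (mem_of_superset (Ioo_mem_nhdsGT Real.pi_pos) Ioo_subset_Icc_self)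

/-- A locally absolutely continuous function on `(0, π)` that vanishes at `0` and has an integrable
derivative `w` is the primitive of `w`. -/
theorem ACLoc.eq_integral {W w : ℝ → ℂ} (hW : ACLoc W)
    (hw : IntervalIntegrable w volume 0 Real.pi)
    (hd : ∀ᵐ θ, θ ∈ Ioo 0 Real.pi → HasDerivAt W (w θ) θ)
    (h0 : Tendsto W (𝓝[>] 0) (𝓝 0)) {θ : ℝ} (hθ : θ ∈ Ioo 0 Real.pi) :
    W θ = ∫ t in (0 : ℝ)..θ, w t := by
  have hmem : ∀ x ∈ Ioo 0 Real.pi, x ∈ uIcc 0 Real.pi := fun x hx => by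
    rw [uIcc_of_le Real.pi_pos.le]; exact ⟨hx.1.le, hx.2.le⟩
  have hθ' := hw.mono_set (uIcc_subset_uIcc_left (hmem θ hθ))
  -- The function `W x + ∫ w` over `[x, θ]` is constantly `W θ` for `x` in `(0, θ)`; comparing with
  -- its limit at `0` gives the claim.
  have key : Tendsto (fun x => W x + ((∫ t in (0 : ℝ)..θ, w t) - ∫ t in (0 : ℝ)..x, w t))
      (𝓝[>] 0) (𝓝 (0 + ((∫ t in (0 : ℝ)..θ, w t) - 0))) :=
    h0.add (tendsto_const_nhds.sub (tendsto_primitive_zero hw))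
  have hconst : ∀ᶠ x in 𝓝[>] (0 : ℝ),
      W x + ((∫ t in (0 : ℝ)..θ, w t) - ∫ t in (0 : ℝ)..x, w t) = W θ := by
    filter_upwards [Ioo_mem_nhdsGT hθ.1] with x hx
    have hx' : x ∈ Ioo 0 Real.pi := ⟨hx.1, hx.2.trans hθ.2⟩
    have hsub := uIcc_subset_uIcc (hmem x hx') (hmem θ hθ)
    have h1 := (hW x θ hx.1 hx.2.le hθ.2).integral_eq_sub_of_ae_hasDerivAt (hw.mono_set hsub) (by
      filter_upwards [hd] with y hy hy'
      rw [uIcc_of_le hx.2.le] at hy'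
      exact hy (Icc_subset_Ioo_pi hx.1 hθ.2 hy'))
    rw [intervalIntegral.integral_interval_sub_left hθ'
      (hw.mono_set (uIcc_subset_uIcc_left (hmem x hx'))), h1]
    ring
  have := tendsto_nhds_unique (tendsto_const_nhds.congr' (hconst.mono fun _ h => h.symm)) key
  simpa using this

theorem tendsto_primitive_pi {w : ℝ → ℂ} (hw : IntervalIntegrable w volume 0 Real.pi) :
    Tendsto (fun x => ∫ t in (0 : ℝ)..x, w t) (𝓝[<] Real.pi)
      (𝓝 (∫ t in (0 : ℝ)..Real.pi, w t)) := by
  have h := intervalIntegral.continuousOn_primitive_interval' hw left_mem_uIcc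
  refine (h Real.pi right_mem_uIcc).mono_left ?_
  rw [uIcc_of_le Real.pi_pos.le]
  exact nhdsWithin_le_of_mem
    (mem_of_superset (Ioo_mem_nhdsLT Real.pi_pos) Ioo_subset_Icc_self)

/-- The limit at `π` of the primitive `W` is both the full integral and zero. -/
theorem ACLoc.integral_eq_zero {W w : ℝ → ℂ} (hW : ACLoc W)
    (hw : IntervalIntegrable w volume 0 Real.pi)
    (hd : ∀ᵐ θ, θ ∈ Ioo 0 Real.pi → HasDerivAt W (w θ) θ)
    (h0 : Tendsto W (𝓝[>] 0) (𝓝 0)) (h1 : Tendsto W (𝓝[<] Real.pi) (𝓝 0)) :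
    ∫ t in (0 : ℝ)..Real.pi, w t = 0 := by
  refine tendsto_nhds_unique (tendsto_primitive_pi hw) (h1.congr' ?_)
  filter_upwards [Ioo_mem_nhdsLT Real.pi_pos] with θ hθ
  exact hW.eq_integral hw hd h0 hθ

/-- The primitive of an integrable function is locally absolutely continuous. -/
theorem acLoc_primitive {w : ℝ → ℂ} (hw : IntervalIntegrable w volume 0 Real.pi) :
    ACLoc (fun x => ∫ t in (0 : ℝ)..x, w t) := fun c d hc hcd hd =>
  (AbsolutelyContinuousOnInterval.intervalIntegral_complex hw left_mem_uIcc).mono (by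
    rw [uIcc_of_le hcd, uIcc_of_le Real.pi_pos.le]
    exact Icc_subset_Icc hc.le hd.le)

/-! ### The weighted space -/

theorem integrable_sinMeasure_iff {E : Type*} [NormedAddCommGroup E] [NormedSpace ℝ E]
    {g : ℝ → E} :
    Integrable g sinMeasure ↔ IntervalIntegrable (fun t => Real.sin t • g t) volume 0 Real.pi := by
  rw [intervalIntegrable_iff_integrableOn_Ioo_of_le Real.pi_pos.le, IntegrableOn, sinMeasure,
    integrable_withDensity_iff_integrable_smul' (by fun_prop) (by simp)]
  refine integrable_congr ?_
  filter_upwards [ae_restrict_mem measurableSet_Ioo] with t ht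
  rw [ENNReal.toReal_ofReal (Real.sin_pos_of_mem_Ioo ht).le]

theorem integral_sinMeasure {E : Type*} [NormedAddCommGroup E] [NormedSpace ℝ E] (g : ℝ → E) :
    ∫ t, g t ∂sinMeasure = ∫ t in (0 : ℝ)..Real.pi, Real.sin t • g t := by
  rw [intervalIntegral.integral_of_le Real.pi_pos.le, integral_Ioc_eq_integral_Ioo, sinMeasure,
    integral_withDensity_eq_integral_toReal_smul (by fun_prop) (by simp)]
  refine setIntegral_congr_fun measurableSet_Ioo fun t ht => ?_
  simp only [ENNReal.toReal_ofReal (Real.sin_pos_of_mem_Ioo ht).le]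

theorem aestronglyMeasurable_sinMeasure_of_continuousOn {g : ℝ → ℂ}
    (hg : ContinuousOn g (Ioo 0 Real.pi)) : AEStronglyMeasurable g sinMeasure :=
  (hg.aestronglyMeasurable measurableSet_Ioo).mono_ac sinMeasure_ac

/-- The weighted square is `sin^{2n+1}`, whose exponent exceeds `-1` exactly when `n > -1`. -/
theorem memLp_sin_rpow {n : ℝ} (hn : -1 < n) :
    MemLp (fun t => ((Real.sin t ^ n : ℝ) : ℂ)) 2 sinMeasure := by
  rw [memLp_two_iff_integrable_sq_norm
    (aestronglyMeasurable_sinMeasure_of_continuousOn (continuousOn_sin_rpow n)),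
    integrable_sinMeasure_iff]
  refine (intervalIntegrable_sin_rpow (a := 2 * n + 1) (by linarith)).congr_uIoo fun t ht => ?_
  rw [uIoo_of_le Real.pi_pos.le] at ht
  have hs := Real.sin_pos_of_mem_Ioo ht
  simp only [Complex.norm_real, Real.norm_of_nonneg (Real.rpow_nonneg hs.le _), smul_eq_mul]
  rw [Real.rpow_add_one hs.ne', mul_comm 2 n, Real.rpow_mul hs.le, Real.rpow_ofNat, mul_comm]

theorem intervalIntegrable_sin_mul_sq {φ : ℝ → ℂ} (hφ : MemLp φ 2 sinMeasure) :
    IntervalIntegrable (fun t => Real.sin t * ‖φ t‖ ^ 2) volume 0 Real.pi :=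
  integrable_sinMeasure_iff.1 ((memLp_two_iff_integrable_sq_norm hφ.1).1 hφ)

theorem sin_mul_sin_rpow (n : ℝ) {θ : ℝ} (hθ : θ ∈ Ioo 0 Real.pi) :
    Real.sin θ * Real.sin θ ^ n = Real.sin θ ^ (n + 1) := by
  rw [Real.rpow_add_one (Real.sin_pos_of_mem_Ioo hθ).ne', mul_comm]

theorem intervalIntegrable_sin_rpow_mul {n : ℝ} (hn : -1 < n) {φ : ℝ → ℂ}
    (hφ : MemLp φ 2 sinMeasure) :
    IntervalIntegrable (fun t => ((Real.sin t ^ (n + 1) : ℝ) : ℂ) * φ t) volume 0 Real.pi := by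
  refine (integrable_sinMeasure_iff.1 ((memLp_sin_rpow hn).integrable_mul hφ)).congr_uIoo
    fun t ht => ?_
  rw [uIoo_of_le Real.pi_pos.le] at ht
  simp only [Pi.mul_apply, Complex.real_smul, ← sin_mul_sin_rpow n ht, Complex.ofReal_mul]
  ring

/-! ### The boundary quantity, the factorization and boundedness of `f / sin^n` -/

theorem bdryQuantity_eq (n : ℝ) {f : ℝ → ℂ} (hf : DifferentiableOn ℝ f (Ioo 0 Real.pi))
    {θ : ℝ} (hθ : θ ∈ Ioo 0 Real.pi) :
    bdryQuantity n f θ = ((Real.sin θ ^ (n + 1) : ℝ) : ℂ) * deriv f θ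
      - n * (((Real.sin θ ^ n : ℝ) : ℂ) * ((Real.cos θ : ℝ) : ℂ) * f θ) := by
  have hs := Real.sin_pos_of_mem_Ioo hθ
  have hp := Real.rpow_pos_of_pos hs n
  have hne : ((Real.sin θ ^ n : ℝ) : ℂ) ≠ 0 := by exact_mod_cast hp.ne'
  have hd := ((hf.differentiableAt (Ioo_mem_nhds hθ.1 hθ.2)).hasDerivAt.div
    (hasDerivAt_sin_rpow n hθ) hne).deriv
  have hd' : deriv (fun t : ℝ => f t / ((Real.sin t ^ n : ℝ) : ℂ)) θ = _ := hd
  have hsC : (Real.sin θ : ℂ) ≠ 0 := by exact_mod_cast hs.ne'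
  rw [bdryQuantity, hd', Real.rpow_add_one hs.ne', Real.rpow_add_one hs.ne', mul_comm 2 n,
    Real.rpow_mul hs.le, Real.rpow_ofNat, Real.rpow_sub_one hs.ne']
  generalize Real.sin θ ^ n = x at *
  push_cast at hsC ⊢
  field_simp

theorem acLoc_bdryQuantity (n : ℝ) {f : ℝ → ℂ} (hf : DifferentiableOn ℝ f (Ioo 0 Real.pi))
    (hf' : ACLoc (deriv f)) : ACLoc (bdryQuantity n f) := by
  have h0 : ACLoc f := .of_continuousOn_deriv hf hf'.continuousOn
  refine ACLoc.congr ?_ fun θ hθ => (bdryQuantity_eq n hf hθ).symm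
  exact ((acLoc_sin_rpow _).mul hf').sub
    ((acLoc_const _).mul (((acLoc_sin_rpow _).mul acLoc_cos).mul h0))

/-- The factorization `(sin^{2n+1} (f / sin^n)')' = sin^{n+1} L f`. -/
theorem hasDerivAt_bdryQuantity (n : ℝ) {f : ℝ → ℂ} (hf : DifferentiableOn ℝ f (Ioo 0 Real.pi))
    {θ : ℝ} (hθ : θ ∈ Ioo 0 Real.pi) (hf' : DifferentiableAt ℝ (deriv f) θ) :
    HasDerivAt (bdryQuantity n f)
      (((Real.sin θ ^ (n + 1) : ℝ) : ℂ) * legendreExpr n n f θ) θ := by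
  have hn := Ioo_mem_nhds hθ.1 hθ.2
  have hs := Real.sin_pos_of_mem_Ioo hθ
  have hsC : (Real.sin θ : ℂ) ≠ 0 := by exact_mod_cast hs.ne'
  have h : HasDerivAt (fun θ => ((Real.sin θ ^ (n + 1) : ℝ) : ℂ) * deriv f θ
      - n * (((Real.sin θ ^ n : ℝ) : ℂ) * ((Real.cos θ : ℝ) : ℂ) * f θ)) _ θ :=
    ((hasDerivAt_sin_rpow (n + 1) hθ).mul hf'.hasDerivAt).sub
      ((((hasDerivAt_sin_rpow n hθ).mul (Real.hasDerivAt_cos θ).ofReal_comp).mul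
        (hf.differentiableAt hn).hasDerivAt).const_mul (n : ℂ))
  refine (h.congr_of_eventuallyEq ?_).congr_deriv ?_
  · filter_upwards [hn] with t ht using bdryQuantity_eq n hf ht
  · rw [legendreExpr, Real.cot_eq_cos_div_sin, add_sub_cancel_right, Real.rpow_add_one hs.ne',
      Real.rpow_sub_one hs.ne']
    have hcs : (Real.cos θ : ℂ) ^ 2 = 1 - (Real.sin θ : ℂ) ^ 2 := by
      rw [eq_sub_iff_add_eq]
      exact_mod_cast Real.cos_sq_add_sin_sq θ
    simp only [Pi.mul_apply]
    generalize Real.sin θ ^ n = x at *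
    push_cast at hcs hsC ⊢
    field_simp
    ring_nf
    rw [hcs]
    ring

theorem ACLoc.ae_differentiableAt_of_mem {f : ℝ → ℂ} (hf : ACLoc f) :
    ∀ᵐ θ, θ ∈ Ioo 0 Real.pi → DifferentiableAt ℝ f θ :=
  (ae_restrict_iff' measurableSet_Ioo).1 (ac_sinMeasure.ae_le hf.ae_differentiableAt)

/-- If `sin^{2n+1} G'` is `O(sin^{n+1})`, then `G` is bounded. -/
theorem exists_bound_of_deriv_bound {n : ℝ} (hn : n < 1) {G P : ℝ → ℂ}
    (hG : ∀ θ ∈ Ioo 0 Real.pi,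
      HasDerivAt G (((Real.sin θ ^ (-(2 * n + 1)) : ℝ) : ℂ) * P θ) θ)
    (hPc : ContinuousOn P (Ioo 0 Real.pi))
    (hP : ∃ C, ∀ θ ∈ Ioo 0 Real.pi, ‖P θ‖ ≤ C * Real.sin θ ^ (n + 1)) :
    ∃ C, ∀ θ ∈ Ioo 0 Real.pi, ‖G θ‖ ≤ C := by
  obtain ⟨C, hC⟩ := hP
  have hmid : Real.pi / 2 ∈ Ioo 0 Real.pi := ⟨by positivity, by linarith [Real.pi_pos]⟩
  -- This is where `n < 1` enters. The exponent is `-(2n + 1) + (n + 1) = -n`.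
  have hint : IntervalIntegrable (fun t => C * Real.sin t ^ (-n)) volume 0 Real.pi :=
    (intervalIntegrable_sin_rpow (by linarith)).const_mul C
  have hC0 : 0 ≤ C := by
    have h := (norm_nonneg _).trans (hC _ hmid)
    simpa using h
  refine ⟨‖G (Real.pi / 2)‖ + ∫ t in (0 : ℝ)..Real.pi, C * Real.sin t ^ (-n), fun θ hθ => ?_⟩
  have hsub : uIcc (Real.pi / 2) θ ⊆ Ioo 0 Real.pi :=
    (convex_Ioo _ _).ordConnected.uIcc_subset hmid hθ
  have hcont : ContinuousOn (fun θ => ((Real.sin θ ^ (-(2 * n + 1)) : ℝ) : ℂ) * P θ)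
      (Ioo 0 Real.pi) := (continuousOn_sin_rpow _).mul hPc
  have hftc := intervalIntegral.integral_eq_sub_of_hasDerivAt (fun t ht => hG t (hsub ht))
    (hcont.mono hsub).intervalIntegrable
  have hbd : ∀ t ∈ Ioo 0 Real.pi,
      ‖((Real.sin t ^ (-(2 * n + 1)) : ℝ) : ℂ) * P t‖ ≤ C * Real.sin t ^ (-n) := fun t ht => by
    have hs := Real.sin_pos_of_mem_Ioo ht
    rw [norm_mul, Complex.norm_real, Real.norm_of_nonneg (Real.rpow_nonneg hs.le _)]
    refine (mul_le_mul_of_nonneg_left (hC t ht) (Real.rpow_nonneg hs.le _)).trans_eq ?_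
    rw [mul_left_comm, ← Real.rpow_add hs]
    ring_nf
  have h1 : ‖G θ - G (Real.pi / 2)‖ ≤ ∫ t in (0 : ℝ)..Real.pi, C * Real.sin t ^ (-n) := by
    rw [← hftc]
    refine (intervalIntegral.norm_integral_le_integral_norm_uIoc).trans ?_
    rw [intervalIntegral.integral_of_le Real.pi_pos.le, integral_Ioc_eq_integral_Ioo]
    have hsub' : uIoc (Real.pi / 2) θ ⊆ Ioo 0 Real.pi := uIoc_subset_uIcc.trans hsub
    have hI := (intervalIntegrable_iff_integrableOn_Ioo_of_le Real.pi_pos.le).1 hint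
    refine (setIntegral_mono_on ?_ (hI.mono_set hsub') measurableSet_uIoc
      fun t ht => hbd t (hsub' ht)).trans (setIntegral_mono_set hI ?_ hsub'.eventuallyLE)
    · exact (intervalIntegrable_iff.1 (hcont.mono hsub).intervalIntegrable).norm
    · filter_upwards [ae_restrict_mem measurableSet_Ioo] with t ht
      exact mul_nonneg hC0 (Real.rpow_nonneg (Real.sin_pos_of_mem_Ioo ht).le _)
  calc ‖G θ‖ = ‖G (Real.pi / 2) + (G θ - G (Real.pi / 2))‖ := by congr 1; ring
    _ ≤ _ := (norm_add_le _ _).trans (by gcongr)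

theorem IsRegularRep.hasDerivAt_bdryQuantity_ae {n : ℝ} {u : L2sin} {f : ℝ → ℂ}
    (hf : IsRegularRep n n u f) : ∀ᵐ θ, θ ∈ Ioo 0 Real.pi → HasDerivAt (bdryQuantity n f)
      (((Real.sin θ ^ (n + 1) : ℝ) : ℂ) * legendreExpr n n f θ) θ := by
  filter_upwards [hf.ac.ae_differentiableAt_of_mem] with θ h hθ
  exact hasDerivAt_bdryQuantity n hf.diff hθ (h hθ)

/-- Functions in the domain are `O(sin^n)`. -/
theorem IsRegularRep.exists_norm_div_le {n : ℝ} (hn : n ∈ Ioo (-1 : ℝ) 1) {u : L2sin} {f : ℝ → ℂ}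
    (hf : IsRegularRep n n u f) (bf : SeparatedBC n f) :
    ∃ C, ∀ θ ∈ Ioo 0 Real.pi, ‖f θ / ((Real.sin θ ^ n : ℝ) : ℂ)‖ ≤ C := by
  have hac := acLoc_bdryQuantity n hf.diff hf.ac
  have hint := intervalIntegrable_sin_rpow_mul hn.1 hf.memLp
  have hd := hf.hasDerivAt_bdryQuantity_ae
  obtain ⟨C, hC⟩ := exists_norm_integral_le hn.1 hint (intervalIntegrable_sin_mul_sq hf.memLp)
    (hac.integral_eq_zero hint hd bf.1 bf.2)
  refine exists_bound_of_deriv_bound hn.2 (P := bdryQuantity n f) (fun θ hθ => ?_)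
    hac.continuousOn ⟨C, fun θ hθ => ?_⟩
  · convert! (differentiableAt_div_sin_rpow n hθ hf.diff).hasDerivAt using 1
    have hs := Real.sin_pos_of_mem_Ioo hθ
    rw [bdryQuantity, ← mul_assoc, ← Complex.ofReal_mul, ← Real.rpow_add hs, neg_add_cancel,
      Real.rpow_zero, Complex.ofReal_one, one_mul]
  · rw [hac.eq_integral hint hd bf.1 hθ]
    exact hC θ hθ

/-! ### Green's formula and solvability -/

/-- The Wronskian identity behind the symmetry of the operator. -/
theorem hasDerivAt_wronskian (n : ℝ) {f g : ℝ → ℂ} {θ : ℝ} (hθ : θ ∈ Ioo 0 Real.pi)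
    (hf : DifferentiableAt ℝ f θ) (hg : DifferentiableAt ℝ g θ)
    (hf' : DifferentiableAt ℝ (deriv f) θ) (hg' : DifferentiableAt ℝ (deriv g) θ) :
    HasDerivAt (fun t => ((Real.sin t : ℝ) : ℂ) * (starRingEnd ℂ (deriv f t) * g t
        - starRingEnd ℂ (f t) * deriv g t))
      (Real.sin θ • (starRingEnd ℂ (legendreExpr n n f θ) * g θ
        - starRingEnd ℂ (f θ) * legendreExpr n n g θ)) θ := by
  have hsC : (Real.sin θ : ℂ) ≠ 0 := by exact_mod_cast (Real.sin_pos_of_mem_Ioo hθ).ne'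
  have h := (Real.hasDerivAt_sin θ).ofReal_comp.mul
    ((hf'.hasDerivAt.star.mul hg.hasDerivAt).sub (hf.hasDerivAt.star.mul hg'.hasDerivAt))
  refine h.congr_deriv ?_
  -- The zeroth-order coefficient is real, so its two contributions cancel, while `sin · cot = cos`
  -- matches the derivative of the weight.
  simp only [legendreExpr, Real.cot_eq_cos_div_sin, map_add, map_mul, Complex.conj_ofReal,
    Complex.real_smul, Complex.star_def, Pi.sub_apply, Pi.mul_apply]
  push_cast at hsC ⊢
  field_simp
  ring

/-- Construction of elements of the domain from a solution of the factored equation. -/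
theorem exists_isRegularRep_of_factored {n : ℝ} (hn : n ∈ Ioo (-1 : ℝ) 1) {G P h : ℝ → ℂ}
    (hG : ∀ θ ∈ Ioo 0 Real.pi,
      HasDerivAt G (((Real.sin θ ^ (-(2 * n + 1)) : ℝ) : ℂ) * P θ) θ)
    (hGb : ∃ C, ∀ θ ∈ Ioo 0 Real.pi, ‖G θ‖ ≤ C) (hP : ACLoc P)
    (hPd : ∀ᵐ θ, θ ∈ Ioo 0 Real.pi → HasDerivAt P (((Real.sin θ ^ (n + 1) : ℝ) : ℂ) * h θ) θ)
    (h0 : Tendsto P (𝓝[>] 0) (𝓝 0)) (h1 : Tendsto P (𝓝[<] Real.pi) (𝓝 0))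
    (hh : MemLp h 2 sinMeasure) :
    ∃ hm : MemLp (fun t => ((Real.sin t ^ n : ℝ) : ℂ) * G t) 2 sinMeasure,
      IsRegularRep n n (hm.toLp _) (fun t => ((Real.sin t ^ n : ℝ) : ℂ) * G t) ∧
      SeparatedBC n (fun t => ((Real.sin t ^ n : ℝ) : ℂ) * G t) ∧
      legendreExpr n n (fun t => ((Real.sin t ^ n : ℝ) : ℂ) * G t) =ᵐ[sinMeasure] h := by
  set f : ℝ → ℂ := fun t => ((Real.sin t ^ n : ℝ) : ℂ) * G t with hfdef
  obtain ⟨C, hC⟩ := hGb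
  have hGc : ContinuousOn G (Ioo 0 Real.pi) :=
    fun θ hθ => (hG θ hθ).continuousAt.continuousWithinAt
  have hm : MemLp f 2 sinMeasure := by
    refine (memLp_sin_rpow hn.1).of_le_mul (c := C)
      (aestronglyMeasurable_sinMeasure_of_continuousOn ((continuousOn_sin_rpow n).mul hGc)) ?_
    filter_upwards [ae_sinMeasure_mem] with θ hθ
    rw [hfdef, norm_mul, mul_comm]
    exact mul_le_mul_of_nonneg_right (hC θ hθ) (norm_nonneg _)
  have hfd : ∀ θ ∈ Ioo 0 Real.pi, HasDerivAt f (((n * Real.sin θ ^ (n - 1) * Real.cos θ : ℝ) : ℂ)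
      * G θ + ((Real.sin θ ^ n : ℝ) : ℂ) * (((Real.sin θ ^ (-(2 * n + 1)) : ℝ) : ℂ) * P θ)) θ :=
    fun θ hθ => (hasDerivAt_sin_rpow n hθ).mul (hG θ hθ)
  have hdiff : DifferentiableOn ℝ f (Ioo 0 Real.pi) :=
    fun θ hθ => (hfd θ hθ).differentiableAt.differentiableWithinAt
  have hGac : ACLoc G := by
    refine .of_continuousOn_deriv
      (fun θ hθ => (hG θ hθ).differentiableAt.differentiableWithinAt) ?_
    exact ((continuousOn_sin_rpow _).mul hP.continuousOn).congr fun θ hθ => (hG θ hθ).deriv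
  have hac : ACLoc (deriv f) := by
    refine ACLoc.congr (f := fun θ => (n : ℂ) * (((Real.sin θ ^ (n - 1) : ℝ) : ℂ)
      * ((Real.cos θ : ℝ) : ℂ) * G θ) + ((Real.sin θ ^ n : ℝ) : ℂ) *
      (((Real.sin θ ^ (-(2 * n + 1)) : ℝ) : ℂ) * P θ)) ?_ fun θ hθ => ?_
    · exact ((acLoc_const _).mul (((acLoc_sin_rpow _).mul acLoc_cos).mul hGac)).add
        ((acLoc_sin_rpow _).mul ((acLoc_sin_rpow _).mul hP))
    · rw [(hfd θ hθ).deriv]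
      push_cast
      ring
  have hbdry : EqOn (bdryQuantity n f) P (Ioo 0 Real.pi) := fun θ hθ => by
    have hs := Real.sin_pos_of_mem_Ioo hθ
    have hev : (fun t : ℝ => f t / ((Real.sin t ^ n : ℝ) : ℂ)) =ᶠ[𝓝 θ] G := by
      filter_upwards [Ioo_mem_nhds hθ.1 hθ.2] with t ht
      have hne : ((Real.sin t ^ n : ℝ) : ℂ) ≠ 0 := by
        exact_mod_cast (Real.rpow_pos_of_pos (Real.sin_pos_of_mem_Ioo ht) n).ne'
      rw [hfdef, mul_div_cancel_left₀ _ hne]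
    rw [bdryQuantity, hev.deriv_eq, (hG θ hθ).deriv, ← mul_assoc, ← Complex.ofReal_mul,
      ← Real.rpow_add hs, add_neg_cancel, Real.rpow_zero, Complex.ofReal_one, one_mul]
  have hL : legendreExpr n n f =ᵐ[sinMeasure] h := by
    have h2 := sinMeasure_ac.ae_le ((ae_restrict_iff' measurableSet_Ioo).2 hPd)
    -- The factorization and `hPd` give two expressions for the derivative of `P`; uniqueness and
    -- cancellation of `sin^{n+1}` identify `L f` with `h`.
    filter_upwards [ae_sinMeasure_mem, hac.ae_differentiableAt, h2] with θ hθ hd hP'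
    have hne : ((Real.sin θ ^ (n + 1) : ℝ) : ℂ) ≠ 0 := by
      exact_mod_cast (Real.rpow_pos_of_pos (Real.sin_pos_of_mem_Ioo hθ) _).ne'
    refine mul_left_cancel₀ hne (((hasDerivAt_bdryQuantity n hdiff hθ hd).congr_of_eventuallyEq
      ?_).unique hP')
    exact (hbdry.eventuallyEq_of_mem (Ioo_mem_nhds hθ.1 hθ.2)).symm
  refine ⟨hm, ⟨hm.coeFn_toLp, hdiff, hac, (memLp_congr_ae hL).2 hh⟩, ⟨?_, ?_⟩, hL⟩
  · exact h0.congr' (hbdry.symm.eventuallyEq_of_mem (Ioo_mem_nhdsGT Real.pi_pos))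
  · exact h1.congr' (hbdry.symm.eventuallyEq_of_mem (Ioo_mem_nhdsLT Real.pi_pos))

/-- Replacing derivatives by boundary quantities leaves the Wronskian unchanged, because the extra
`n cos` terms cancel. Each resulting product has one bounded factor and one that tends to zero. -/
theorem SeparatedBC.tendsto_wronskian {n : ℝ} {f g : ℝ → ℂ}
    (hf : DifferentiableOn ℝ f (Ioo 0 Real.pi)) (hg : DifferentiableOn ℝ g (Ioo 0 Real.pi))
    (hfb : ∃ C, ∀ θ ∈ Ioo 0 Real.pi, ‖f θ / ((Real.sin θ ^ n : ℝ) : ℂ)‖ ≤ C)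
    (hgb : ∃ C, ∀ θ ∈ Ioo 0 Real.pi, ‖g θ / ((Real.sin θ ^ n : ℝ) : ℂ)‖ ≤ C)
    {l : Filter ℝ} (hl : ∀ᶠ θ in l, θ ∈ Ioo 0 Real.pi) (bf : Tendsto (bdryQuantity n f) l (𝓝 0))
    (bg : Tendsto (bdryQuantity n g) l (𝓝 0)) :
    Tendsto (fun t => ((Real.sin t : ℝ) : ℂ) * (starRingEnd ℂ (deriv f t) * g t
      - starRingEnd ℂ (f t) * deriv g t)) l (𝓝 0) := by
  obtain ⟨C, hC⟩ := hfb
  obtain ⟨D, hD⟩ := hgb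
  have h0 : Tendsto (fun t => ‖bdryQuantity n f t‖ * D + C * ‖bdryQuantity n g t‖) l (𝓝 0) := by
    simpa using (bf.norm.mul_const D).add (bg.norm.const_mul C)
  refine squeeze_zero_norm' ?_ h0
  filter_upwards [hl] with θ hθ
  have hs := Real.sin_pos_of_mem_Ioo hθ
  have hne : ((Real.sin θ ^ n : ℝ) : ℂ) ≠ 0 := by exact_mod_cast (Real.rpow_pos_of_pos hs n).ne'
  have hW : ((Real.sin θ : ℝ) : ℂ) * (starRingEnd ℂ (deriv f θ) * g θ
      - starRingEnd ℂ (f θ) * deriv g θ)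
      = starRingEnd ℂ (bdryQuantity n f θ) * (g θ / ((Real.sin θ ^ n : ℝ) : ℂ))
        - starRingEnd ℂ (f θ / ((Real.sin θ ^ n : ℝ) : ℂ)) * bdryQuantity n g θ := by
    rw [bdryQuantity_eq n hf hθ, bdryQuantity_eq n hg hθ, Real.rpow_add_one hs.ne']
    simp only [map_sub, map_mul, map_div₀, Complex.conj_ofReal, Complex.ofReal_mul]
    field_simp
    ring
  rw [hW]
  refine (norm_sub_le _ _).trans ?_
  rw [norm_mul, norm_mul, RCLike.norm_conj, RCLike.norm_conj]
  gcongr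
  · exact hD θ hθ
  · exact hC θ hθ

/-- Green's formula without boundary terms. -/
theorem IsRegularRep.inner_legendre_eq {n : ℝ} (hn : n ∈ Ioo (-1 : ℝ) 1) {u v : L2sin}
    {f g : ℝ → ℂ} (hf : IsRegularRep n n u f) (bf : SeparatedBC n f)
    (hg : IsRegularRep n n v g) (bg : SeparatedBC n g) :
    inner ℂ (hf.memLp.toLp _) v = inner ℂ u (hg.memLp.toLp _) := by
  have hfm : MemLp f 2 sinMeasure := (memLp_congr_ae hf.ae_eq).1 (Lp.memLp u)
  have hgm : MemLp g 2 sinMeasure := (memLp_congr_ae hg.ae_eq).1 (Lp.memLp v)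
  have i1 : Integrable (fun t => starRingEnd ℂ (legendreExpr n n f t) * g t) sinMeasure :=
    hf.memLp.star.integrable_mul hgm
  have i2 : Integrable (fun t => starRingEnd ℂ (f t) * legendreExpr n n g t) sinMeasure :=
    hfm.star.integrable_mul hg.memLp
  have e1 : inner ℂ (hf.memLp.toLp _) v
      = ∫ t, starRingEnd ℂ (legendreExpr n n f t) * g t ∂sinMeasure := by
    rw [L2.inner_def]
    refine integral_congr_ae ?_
    filter_upwards [hf.memLp.coeFn_toLp, hg.ae_eq] with t h1 h2
    rw [h1, h2, RCLike.inner_apply, mul_comm]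
  have e2 : inner ℂ u (hg.memLp.toLp _)
      = ∫ t, starRingEnd ℂ (f t) * legendreExpr n n g t ∂sinMeasure := by
    rw [L2.inner_def]
    refine integral_congr_ae ?_
    filter_upwards [hg.memLp.coeFn_toLp, hf.ae_eq] with t h1 h2
    rw [h1, h2, RCLike.inner_apply, mul_comm]
  rw [e1, e2, ← sub_eq_zero, ← integral_sub i1 i2, integral_sinMeasure]
  have hfa : ACLoc f := .of_continuousOn_deriv hf.diff hf.ac.continuousOn
  have hga : ACLoc g := .of_continuousOn_deriv hg.diff hg.ac.continuousOn
  have hW : ACLoc (fun t => ((Real.sin t : ℝ) : ℂ) * (starRingEnd ℂ (deriv f t) * g t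
      - starRingEnd ℂ (f t) * deriv g t)) :=
    (ACLoc.of_contDiffOn (Complex.ofRealCLM.contDiff.comp Real.contDiff_sin).contDiffOn).mul
      ((hf.ac.star.mul hga).sub (hfa.star.mul hg.ac))
  have hfb := hf.exists_norm_div_le hn bf
  have hgb := hg.exists_norm_div_le hn bg
  refine hW.integral_eq_zero (integrable_sinMeasure_iff.1 (i1.sub i2)) ?_
    (SeparatedBC.tendsto_wronskian hf.diff hg.diff hfb hgb (Ioo_mem_nhdsGT Real.pi_pos) bf.1 bg.1)
    (SeparatedBC.tendsto_wronskian hf.diff hg.diff hfb hgb (Ioo_mem_nhdsLT Real.pi_pos) bf.2 bg.2)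
  filter_upwards [hf.ac.ae_differentiableAt_of_mem, hg.ac.ae_differentiableAt_of_mem]
    with θ h1 h2 hθ
  have hnh := Ioo_mem_nhds hθ.1 hθ.2
  exact hasDerivAt_wronskian n hθ (hf.diff.differentiableAt hnh) (hg.diff.differentiableAt hnh)
    (h1 hθ) (h2 hθ)

/-- Multiples of `sin^n` lie in the domain and are annihilated by the operator. -/
theorem exists_isRegularRep_const_mul_sin_rpow {n : ℝ} (hn : n ∈ Ioo (-1 : ℝ) 1) (c : ℂ) :
    ∃ hm : MemLp (fun t => ((Real.sin t ^ n : ℝ) : ℂ) * c) 2 sinMeasure,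
      IsRegularRep n n (hm.toLp _) (fun t => ((Real.sin t ^ n : ℝ) : ℂ) * c) ∧
      SeparatedBC n (fun t => ((Real.sin t ^ n : ℝ) : ℂ) * c) ∧
      legendreExpr n n (fun t => ((Real.sin t ^ n : ℝ) : ℂ) * c) =ᵐ[sinMeasure] 0 :=
  -- A constant quotient `f / sin^n` has zero boundary quantity, so it solves the factored equation
  -- with zero right-hand side.
  exists_isRegularRep_of_factored (G := fun _ => c) (P := fun _ => 0) (h := 0) hn
    (fun θ _ => by simpa using hasDerivAt_const θ c) ⟨‖c‖, fun _ _ => le_rfl⟩ (acLoc_const 0)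
    (Eventually.of_forall fun θ _ => by simpa using hasDerivAt_const θ (0 : ℂ))
    tendsto_const_nhds tendsto_const_nhds MemLp.zero

/-- The equation `L f = h` is solvable in the domain when `h` is orthogonal to `sin^n`. -/
theorem exists_isRegularRep_legendreExpr_eq {n : ℝ} (hn : n ∈ Ioo (-1 : ℝ) 1) {h : ℝ → ℂ}
    (hh : MemLp h 2 sinMeasure)
    (h0 : ∫ t in (0 : ℝ)..Real.pi, ((Real.sin t ^ (n + 1) : ℝ) : ℂ) * h t = 0) :
    ∃ (u : L2sin) (f : ℝ → ℂ), IsRegularRep n n u f ∧ SeparatedBC n f ∧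
      legendreExpr n n f =ᵐ[sinMeasure] h := by
  have hint := intervalIntegrable_sin_rpow_mul hn.1 hh
  set P : ℝ → ℂ := fun θ => ∫ t in (0 : ℝ)..θ, ((Real.sin t ^ (n + 1) : ℝ) : ℂ) * h t with hPdef
  have hP : ACLoc P := acLoc_primitive hint
  have hmid : Real.pi / 2 ∈ Ioo 0 Real.pi := ⟨by positivity, by linarith [Real.pi_pos]⟩
  have hcont : ContinuousOn (fun θ => ((Real.sin θ ^ (-(2 * n + 1)) : ℝ) : ℂ) * P θ)
      (Ioo 0 Real.pi) := (continuousOn_sin_rpow _).mul hP.continuousOn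
  -- The second integration starts at an interior point, where the integrand is continuous; another
  -- interior base point would only add a multiple of `sin^n` to the solution.
  have hG : ∀ θ ∈ Ioo 0 Real.pi, HasDerivAt
      (fun x => ∫ t in (Real.pi / 2)..x, ((Real.sin t ^ (-(2 * n + 1)) : ℝ) : ℂ) * P t)
      (((Real.sin θ ^ (-(2 * n + 1)) : ℝ) : ℂ) * P θ) θ := fun θ hθ => by
    have hsub : uIcc (Real.pi / 2) θ ⊆ Ioo 0 Real.pi :=
      (convex_Ioo _ _).ordConnected.uIcc_subset hmid hθ
    exact intervalIntegral.integral_hasDerivAt_right (hcont.mono hsub).intervalIntegrable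
      (hcont.stronglyMeasurableAtFilter isOpen_Ioo θ hθ)
      (hcont.continuousAt (Ioo_mem_nhds hθ.1 hθ.2))
  have hPb := exists_norm_integral_le hn.1 hint (intervalIntegrable_sin_mul_sq hh) h0
  obtain ⟨hm, hr, hb, hL⟩ := exists_isRegularRep_of_factored hn hG
    (exists_bound_of_deriv_bound hn.2 hG hP.continuousOn hPb) hP (by
      filter_upwards [hint.ae_hasDerivAt_integral] with θ hd hθ
      rw [uIcc_of_le Real.pi_pos.le] at hd
      exact hd ⟨hθ.1.le, hθ.2.le⟩ 0 ⟨le_rfl, Real.pi_pos.le⟩)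
    (tendsto_primitive_zero hint) (h0 ▸ tendsto_primitive_pi hint) hh
  exact ⟨_, _, hr, hb, hL⟩

/-! ### Self-adjointness and the Hopf profile -/

theorem DSA_le_Dmax (n : ℝ) : DSA n ≤ Dmax n n := fun _ ⟨f, hf, _⟩ => ⟨f, hf⟩

theorem mem_domain_legendreMax_domRestrict {n : ℝ} {u : L2sin} (hu : u ∈ DSA n) :
    u ∈ ((legendreMax n n).domRestrict (DSA n)).domain :=
  ⟨hu, DSA_le_Dmax n hu⟩

theorem legendreMax_domRestrict_mk {n : ℝ} {u : L2sin}
    (hu : u ∈ ((legendreMax n n).domRestrict (DSA n)).domain) {f : ℝ → ℂ}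
    (hf : IsRegularRep n n u f) :
    (legendreMax n n).domRestrict (DSA n) ⟨u, hu⟩ = hf.memLp.toLp _ :=
  legendreFun_eq ⟨u, hu.2⟩ hf

theorem legendreMax_domRestrict_mk_eq {n : ℝ} {u h : L2sin}
    (hu : u ∈ ((legendreMax n n).domRestrict (DSA n)).domain) {f : ℝ → ℂ}
    (hf : IsRegularRep n n u f) (hL : legendreExpr n n f =ᵐ[sinMeasure] h) :
    (legendreMax n n).domRestrict (DSA n) ⟨u, hu⟩ = h :=
  (legendreMax_domRestrict_mk hu hf).trans (Lp.ext (hf.memLp.coeFn_toLp.trans hL))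

theorem isSelfAdjoint_legendreMax_domRestrict {n : ℝ} (hn : n ∈ Ioo (-1 : ℝ) 1) :
    IsSelfAdjoint ((legendreMax n n).domRestrict (DSA n)) := by
  obtain ⟨hm, hr, hb, hL⟩ := exists_isRegularRep_const_mul_sin_rpow hn 1
  have hk : hm.toLp _ ∈ DSA n := ⟨_, hr, hb⟩
  obtain ⟨k, hkd⟩ : ∃ k, k = hm.toLp _ := ⟨_, rfl⟩
  rw [← hkd] at hk hr
  have hk' := mem_domain_legendreMax_domRestrict hk
  refine LinearPMap.isSelfAdjoint_of_range_orthogonal_ker _ ?_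
    ⟨k, hk'⟩ ?_ fun h hh => ?_
  · rintro ⟨u, hu⟩ ⟨v, hv⟩
    obtain ⟨f, hf, bf⟩ := hu.1
    obtain ⟨g, hg, bg⟩ := hv.1
    rw [legendreMax_domRestrict_mk hu hf, legendreMax_domRestrict_mk hv hg]
    exact hf.inner_legendre_eq hn bf hg bg
  · exact legendreMax_domRestrict_mk_eq hk' hr (hL.trans (Lp.coeFn_zero ℂ 2 sinMeasure).symm)
  -- The inner product with `k = sin^n` in the weight `sin` is the integral of `sin^{n+1} h`, so
  -- orthogonality is the solvability condition.
  · have h0 : ∫ t in (0 : ℝ)..Real.pi, ((Real.sin t ^ (n + 1) : ℝ) : ℂ) * h t = 0 := by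
      change inner ℂ k h = 0 at hh
      rw [← hh, hkd, L2.inner_def, integral_congr_ae (g := fun t => ((Real.sin t ^ n : ℝ) : ℂ) * h t),
        integral_sinMeasure]
      · refine intervalIntegral.integral_congr_uIoo fun t ht => ?_
        rw [uIoo_of_le Real.pi_pos.le] at ht
        simp only [Complex.real_smul, ← sin_mul_sin_rpow n ht, Complex.ofReal_mul]
        ring
      · filter_upwards [hm.coeFn_toLp] with t ht
        rw [ht, RCLike.inner_apply, mul_one, Complex.conj_ofReal, mul_comm]
    obtain ⟨u, f, hf, bf, hLf⟩ := exists_isRegularRep_legendreExpr_eq hn (Lp.memLp h) h0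
    have hu : u ∈ DSA n := ⟨f, hf, bf⟩
    exact ⟨⟨u, mem_domain_legendreMax_domRestrict hu⟩, legendreMax_domRestrict_mk_eq _ hf hLf⟩

theorem hopfProfile_mem_DSA {n : ℝ} (hn : n ∈ Ioo (-1 : ℝ) 1) (C₀ : ℝ) :
    ∃ h : MemLp (hopfProfile C₀ n) 2 sinMeasure, h.toLp (hopfProfile C₀ n) ∈ DSA n := by
  obtain ⟨hm, hr, hb, -⟩ := exists_isRegularRep_const_mul_sin_rpow hn (C₀ : ℂ)
  have he : hopfProfile C₀ n =ᵐ[sinMeasure] fun t => ((Real.sin t ^ n : ℝ) : ℂ) * C₀ := by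
    filter_upwards [ae_sinMeasure_mem] with θ hθ
    rw [hopfProfile_eq C₀ n hθ, Complex.ofReal_mul, mul_comm]
  refine ⟨(memLp_congr_ae he).2 hm, ?_⟩
  rw [MemLp.toLp_congr _ hm he]
  exact ⟨_, hr, hb⟩

end LegendreSL

end

/-- For `n ∈ (-1, 1)`, the separated boundary conditions cut out of the maximal domain a domain on
which the Legendre operator is self-adjoint, and the Hopf profile belongs to that domain. -/
theorem mainTheorem8 (n : ℝ) (hn : n ∈ Set.Ioo (-1 : ℝ) 1) :
    LegendreSL.DSA n ≤ LegendreSL.Dmax n n ∧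
      IsSelfAdjoint ((LegendreSL.legendreMax n n).domRestrict (LegendreSL.DSA n)) ∧
      ∀ C₀ : ℝ,
        ∃ h : MeasureTheory.MemLp (LegendreSL.hopfProfile C₀ n) 2 LegendreSL.sinMeasure,
          h.toLp (LegendreSL.hopfProfile C₀ n) ∈ LegendreSL.DSA n :=
  ⟨LegendreSL.DSA_le_Dmax n, LegendreSL.isSelfAdjoint_legendreMax_domRestrict hn,
    LegendreSL.hopfProfile_mem_DSA hn⟩
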